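/- Let $M$ be a smooth manifold, let $(A,[\cdot,\cdot],\rho)$ be a Lie algebroid over $M$ (a smooth real vector bundle of finite rank), let $\pi\in\Gamma(\bigwedge^2A)$ be a Poisson bivector, i.e. $[\pi,\pi]_{SN}=0$ for the Schouten–Nijenhuis bracket, and let $\omega\in\Gamma(\bigwedge^2A^*)$ be an arbitrary $2$-form. Put $\pi^\sharp(\alpha)=\pi(\alpha,\cdot)$, $\omega^\flat(X)=\omega(X,\cdot)$, $N=\pi^\sharp\circ\omega^\flat\in\Gamma(A\otimes A^*)$, $\omega_N(X,Y)=\omega(NX,Y)$. Then $\omega_N$ is a $2$-form, and $(\pi,N,\psi,H)$ with $\psi=d\omega_N$ and $H=-d\omega$ is a Poisson quasi-Nijenhuis structure with background on $A$. This means: $N\circ\pi^\sharp=\pi^\sharp\circ{}^tN$, $d\psi=0$, $dH=0$, the bivector $\pi$ is Poisson, and for all $X,Y\in\Gamma(A)$, $\alpha,\beta\in\Gamma(A^*)$, $$C_{\pi,N}(\alpha,\beta)=2\,H(\pi^\sharp\alpha,\pi^\sharp\beta,\cdot),$$ $$T_N(X,Y)=-\pi^\sharp\big(H(NX,Y,\cdot)-H(NY,X,\cdot)+\psi(X,Y,\cdot)\big),$$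 $$d_N\psi=d\mathcal H,\qquad \mathcal H(X,Y,Z)=H(NX,NY,Z)+H(NY,NZ,X)+H(NZ,NX,Y).$$ Here $d$ is the Lie algebroid differential (given by the Koszul formula without numerical factor, e.g. $df(X)=\rho(X)f$); $d_N$ is given by the same formula with the bracket $[X,Y]_N=[NX,Y]+[X,NY]-N[X,Y]$ and the anchor $\rho\circ N$; $T_N(X,Y)=[NX,NY]-N[X,Y]_N$; ${}^tN\alpha=\alpha\circ N$; $[\alpha,\beta]_\pi=\mathcal L_{\pi^\sharp\alpha}\beta-\mathcal L_{\pi^\sharp\beta}\alpha-d(\pi(\alpha,\beta))$; and $C_{\pi,N}=([\cdot,\cdot]_N)_\pi-([\cdot,\cdot]_\pi)_{{}^tN}$, where $([\cdot,\cdot]_N)_\pi$ is obtained from the formula for $[\cdot,\cdot]_\pi$ by replacing the bracket and anchor of $A$ by $[\cdot,\cdot]_N$ and $\rho\circ N$ (also in $\mathcal L$ and $d$), and $([\alpha,\beta]_\pi)_{{}^tN}=[{}^tN\alpha,\beta]_\pi+[\alpha,{}^tN\beta]_\pi-{}^tN[\alpha,\beta]_\pi$. -/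

import Mathlib

open scoped Manifold

/-!
# Differential calculus of a bracket and an anchor on a module

In this part `R` plays the role of the ring `C^∞(M)` of smooth functions and `L` that of the
`C^∞(M)`-module `Γ(A)` of smooth sections of a vector bundle `A → M` of finite rank. Sections of the
tensor bundles of `A` are written, as usual, as `C^∞(M)`-multilinear objects:
* `Γ(A*)` is `Module.Dual R L`;
* `Γ(⋀ᵏ A*)` is the module of alternating `R`-multilinear maps from `k` copies of `L` to `R`;
* `Γ(A ⊗ A*)` is the module of `R`-linear endomorphisms of `L`;
* `Γ(⋀² A)` is the set of skew-symmetric `R`-linear maps `Γ(A*) → Γ(A)`.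
-/

noncomputable section

namespace PqN

/-- `k`-forms. -/
abbrev KForm (R L : Type*) [CommRing R] [AddCommGroup L] [Module R L] (k : ℕ) : Type _ :=
  L [⋀^Fin k]→ₗ[R] R

section Forms

variable {R L : Type*} [CommRing R] [AddCommGroup L] [Module R L]

theorem KForm.add₂ (η : KForm R L 2) (x y y' : L) : η ![x, y + y'] = η ![x, y] + η ![x, y'] := by
  have e : ∀ w, Function.update ![x, y] (1 : Fin 2) w = ![x, w] := fun w => by
    funext j; fin_cases j <;> rfl
  have h := η.map_update_add ![x, y] (1 : Fin 2) y y'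
  rwa [e, e, e] at h

theorem KForm.smul₂ (η : KForm R L 2) (x y : L) (f : R) : η ![x, f • y] = f * η ![x, y] := by
  have e : ∀ w, Function.update ![x, y] (1 : Fin 2) w = ![x, w] := fun w => by
    funext j; fin_cases j <;> rfl
  have h := η.map_update_smul ![x, y] (1 : Fin 2) f y
  rwa [e, e] at h

theorem KForm.self₂ (η : KForm R L 2) (x : L) : η ![x, x] = 0 :=
  η.map_eq_zero_of_eq ![x, x] (i := 0) (j := 1) (by simp) (by decide)

theorem KForm.add₁ (η : KForm R L 2) (x x' y : L) : η ![x + x', y] = η ![x, y] + η ![x', y] := by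
  have e : ∀ w, Function.update ![x, y] (0 : Fin 2) w = ![w, y] := fun w => by
    funext j; fin_cases j <;> rfl
  have h := η.map_update_add ![x, y] (0 : Fin 2) x x'
  rwa [e, e, e] at h

theorem KForm.smul₁ (η : KForm R L 2) (x y : L) (f : R) : η ![f • x, y] = f * η ![x, y] := by
  have e : ∀ w, Function.update ![x, y] (0 : Fin 2) w = ![w, y] := fun w => by
    funext j; fin_cases j <;> rfl
  have h := η.map_update_smul ![x, y] (0 : Fin 2) f x
  rwa [e, e] at h

theorem KForm.swap₂ (η : KForm R L 2) (x y : L) : η ![x, y] = -η ![y, x] := by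
  have h := η.self₂ (x + y)
  rw [η.add₁, η.add₂, η.add₂, η.self₂, η.self₂] at h
  linear_combination h

theorem KForm.add₃₁ (η : KForm R L 3) (x x' y z : L) :
    η ![x + x', y, z] = η ![x, y, z] + η ![x', y, z] := by
  have e : ∀ w, Function.update ![x, y, z] (0 : Fin 3) w = ![w, y, z] := fun w => by
    funext j; fin_cases j <;> rfl
  have h := η.map_update_add ![x, y, z] (0 : Fin 3) x x'
  rwa [e, e, e] at h

theorem KForm.smul₃₁ (η : KForm R L 3) (x y z : L) (f : R) :
    η ![f • x, y, z] = f * η ![x, y, z] := by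
  have e : ∀ w, Function.update ![x, y, z] (0 : Fin 3) w = ![w, y, z] := fun w => by
    funext j; fin_cases j <;> rfl
  have h := η.map_update_smul ![x, y, z] (0 : Fin 3) f x
  rwa [e, e] at h

theorem KForm.add₃₂ (η : KForm R L 3) (x y y' z : L) :
    η ![x, y + y', z] = η ![x, y, z] + η ![x, y', z] := by
  have e : ∀ w, Function.update ![x, y, z] (1 : Fin 3) w = ![x, w, z] := fun w => by
    funext j; fin_cases j <;> rfl
  have h := η.map_update_add ![x, y, z] (1 : Fin 3) y y'
  rwa [e, e, e] at h

theorem KForm.smul₃₂ (η : KForm R L 3) (x y z : L) (f : R) :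
    η ![x, f • y, z] = f * η ![x, y, z] := by
  have e : ∀ w, Function.update ![x, y, z] (1 : Fin 3) w = ![x, w, z] := fun w => by
    funext j; fin_cases j <;> rfl
  have h := η.map_update_smul ![x, y, z] (1 : Fin 3) f y
  rwa [e, e] at h

theorem KForm.add₃₃ (η : KForm R L 3) (x y z z' : L) :
    η ![x, y, z + z'] = η ![x, y, z] + η ![x, y, z'] := by
  have e : ∀ w, Function.update ![x, y, z] (2 : Fin 3) w = ![x, y, w] := fun w => by
    funext j; fin_cases j <;> rfl
  have h := η.map_update_add ![x, y, z] (2 : Fin 3) z z'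
  rwa [e, e, e] at h

theorem KForm.smul₃₃ (η : KForm R L 3) (x y z : L) (f : R) :
    η ![x, y, f • z] = f * η ![x, y, z] := by
  have e : ∀ w, Function.update ![x, y, z] (2 : Fin 3) w = ![x, y, w] := fun w => by
    funext j; fin_cases j <;> rfl
  have h := η.map_update_smul ![x, y, z] (2 : Fin 3) f z
  rwa [e, e] at h

theorem KForm.self₃₁₂ (η : KForm R L 3) (x z : L) : η ![x, x, z] = 0 :=
  η.map_eq_zero_of_eq ![x, x, z] (i := 0) (j := 1) (by simp) (by decide)

theorem KForm.self₃₂₃ (η : KForm R L 3) (x z : L) : η ![x, z, z] = 0 :=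
  η.map_eq_zero_of_eq ![x, z, z] (i := 1) (j := 2) (by simp) (by decide)

theorem KForm.self₃₁₃ (η : KForm R L 3) (x y : L) : η ![x, y, x] = 0 :=
  η.map_eq_zero_of_eq ![x, y, x] (i := 0) (j := 2) (by simp) (by decide)

/-- A `2`-form from an alternating biadditive, `R`-bilinear function. -/
def mkForm₂ (f : L → L → R)
    (add₁ : ∀ x x' y, f (x + x') y = f x y + f x' y) (smul₁ : ∀ (c : R) x y, f (c • x) y = c * f x y)
    (add₂ : ∀ x y y', f x (y + y') = f x y + f x y') (smul₂ : ∀ (c : R) x y, f x (c • y) = c * f x y)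
    (self : ∀ x, f x x = 0) : KForm R L 2 where
  toFun v := f (v 0) (v 1)
  map_update_add' {inst} m i x y := by
    rw [Subsingleton.elim inst (instDecidableEqFin 2)]
    fin_cases i <;> simp [add₁, add₂]
  map_update_smul' {inst} m i c x := by
    rw [Subsingleton.elim inst (instDecidableEqFin 2)]
    fin_cases i <;> simp [smul₁, smul₂]
  map_eq_zero_of_eq' v i j h hij := by
    have key : v 0 = v 1 → f (v 0) (v 1) = 0 := fun e => by rw [e, self]
    fin_cases i <;> fin_cases j
    · exact absurd rfl hij
    · exact key h
    · exact key h.symm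
    · exact absurd rfl hij

/-- A `3`-form from an alternating triadditive, `R`-trilinear function. -/
def mkForm₃ (f : L → L → L → R)
    (add₁ : ∀ x x' y z, f (x + x') y z = f x y z + f x' y z)
    (smul₁ : ∀ (c : R) x y z, f (c • x) y z = c * f x y z)
    (add₂ : ∀ x y y' z, f x (y + y') z = f x y z + f x y' z)
    (smul₂ : ∀ (c : R) x y z, f x (c • y) z = c * f x y z)
    (add₃ : ∀ x y z z', f x y (z + z') = f x y z + f x y z')
    (smul₃ : ∀ (c : R) x y z, f x y (c • z) = c * f x y z)
    (self₁₂ : ∀ x z, f x x z = 0) (self₂₃ : ∀ x y, f x y y = 0) (self₁₃ : ∀ x y, f x y x = 0) :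
    KForm R L 3 where
  toFun v := f (v 0) (v 1) (v 2)
  map_update_add' {inst} m i x y := by
    rw [Subsingleton.elim inst (instDecidableEqFin 3)]
    fin_cases i
    · exact add₁ _ _ _ _
    · exact add₂ _ _ _ _
    · exact add₃ _ _ _ _
  map_update_smul' {inst} m i c x := by
    rw [Subsingleton.elim inst (instDecidableEqFin 3)]
    fin_cases i
    · exact smul₁ _ _ _ _
    · exact smul₂ _ _ _ _
    · exact smul₃ _ _ _ _
  map_eq_zero_of_eq' v i j h hij := by
    have h₁₂ : v 0 = v 1 → f (v 0) (v 1) (v 2) = 0 := fun e => by rw [e, self₁₂]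
    have h₂₃ : v 1 = v 2 → f (v 0) (v 1) (v 2) = 0 := fun e => by rw [e, self₂₃]
    have h₁₃ : v 0 = v 2 → f (v 0) (v 1) (v 2) = 0 := fun e => by rw [e, self₁₃]
    fin_cases i <;> fin_cases j
    · exact absurd rfl hij
    · exact h₁₂ h
    · exact h₁₃ h
    · exact h₁₂ h.symm
    · exact absurd rfl hij
    · exact h₂₃ h
    · exact h₁₃ h.symm
    · exact h₂₃ h.symm
    · exact absurd rfl hij

/-- The `1`-form `ω(X, ·)`; the assignment is the map `ω♭`. -/
def flat (ω : KForm R L 2) : L →ₗ[R] Module.Dual R L where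
  toFun X :=
    { toFun := fun Y => ω ![X, Y]
      map_add' := fun Y Y' => ω.add₂ X Y Y'
      map_smul' := fun f Y => ω.smul₂ X Y f }
  map_add' X X' := by ext Y; exact ω.add₁ X X' Y
  map_smul' f X := by ext Y; exact ω.smul₁ X Y f

/-- The `1`-form `η(X, Y, ·)`. -/
def contract (η : KForm R L 3) (X Y : L) : Module.Dual R L where
  toFun Z := η ![X, Y, Z]
  map_add' Z Z' := η.add₃₃ X Y Z Z'
  map_smul' f Z := η.smul₃₃ X Y Z f

/-- The `3`-form `𝓗(X,Y,Z) = H(NX,NY,Z) + H(NY,NZ,X) + H(NZ,NX,Y)`. -/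
def cyclicForm (N : L →ₗ[R] L) (H : KForm R L 3) : KForm R L 3 :=
  mkForm₃ (fun X Y Z => H ![N X, N Y, Z] + H ![N Y, N Z, X] + H ![N Z, N X, Y])
    (by intros; simp only [map_add, H.add₃₁, H.add₃₂, H.add₃₃]; ring)
    (by intros; simp only [map_smul, H.smul₃₁, H.smul₃₂, H.smul₃₃]; ring)
    (by intros; simp only [map_add, H.add₃₁, H.add₃₂, H.add₃₃]; ring)
    (by intros; simp only [map_smul, H.smul₃₁, H.smul₃₂, H.smul₃₃]; ring)
    (by intros; simp only [map_add, H.add₃₁, H.add₃₂, H.add₃₃]; ring)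
    (by intros; simp only [map_smul, H.smul₃₁, H.smul₃₂, H.smul₃₃]; ring)
    (by
      intro x z
      have h := H.self₃₁₂ (N x + N z) x
      simp only [H.add₃₁, H.add₃₂, H.self₃₁₂] at h
      rw [H.self₃₁₂]
      linear_combination h)
    (by
      intro x y
      have h := H.self₃₁₂ (N x + N y) y
      simp only [H.add₃₁, H.add₃₂, H.self₃₁₂] at h
      rw [H.self₃₁₂]
      linear_combination h)
    (by
      intro x y
      have h := H.self₃₁₂ (N x + N y) x
      simp only [H.add₃₁, H.add₃₂, H.self₃₁₂] at h
      rw [H.self₃₁₂]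
      linear_combination h)

end Forms

/-- A bivector `π ∈ Γ(⋀² A)`, given by the skew-symmetric map `π♯ : Γ(A*) → Γ(A)`,
`π♯(α) = π(α, ·)`, that is `β (π♯ α) = π(α, β)`. -/
structure Bivector (R L : Type*) [CommRing R] [AddCommGroup L] [Module R L] where
  sharp : Module.Dual R L →ₗ[R] L
  skew : ∀ α : Module.Dual R L, α (sharp α) = 0

namespace Bivector

variable {R L : Type*} [CommRing R] [AddCommGroup L] [Module R L]

/-- `π(α, β)`. -/
def eval (π : Bivector R L) (α β : Module.Dual R L) : R := β (π.sharp α)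

theorem eval_swap (π : Bivector R L) (α β : Module.Dual R L) :
    β (π.sharp α) = -α (π.sharp β) := by
  have h := π.skew (α + β)
  simp only [map_add, LinearMap.add_apply, π.skew] at h
  linear_combination h

/-- The decomposable bivector `X ∧ Y`, `(X ∧ Y)(α, β) = α(X) β(Y) - α(Y) β(X)`. -/
def wedge (X Y : L) : Bivector R L where
  sharp :=
    { toFun := fun α => α X • Y - α Y • X
      map_add' := fun α β => by simp only [LinearMap.add_apply, add_smul]; abel
      map_smul' := fun f α => by simp [mul_smul, smul_sub] }
  skew α := by simp [mul_comm]

/-- The endomorphism `N = π♯ ∘ ω♭`. -/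
def endo (π : Bivector R L) (ω : KForm R L 2) : L →ₗ[R] L := π.sharp ∘ₗ flat ω

/-- The `2`-form `ω_N(X, Y) = ω(NX, Y)`, where `N = π♯ ∘ ω♭`. -/
def twistedForm (π : Bivector R L) (ω : KForm R L 2) : KForm R L 2 :=
  mkForm₂ (fun X Y => ω ![π.endo ω X, Y])
    (by intros; simp only [map_add, ω.add₁]) (by intros; simp only [map_smul, ω.smul₁])
    (by intros; simp only [ω.add₂]) (by intros; simp only [ω.smul₂])
    (by
      intro X
      have h : ω ![X, π.endo ω X] = 0 := π.skew (flat ω X)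
      rw [ω.swap₂, h, neg_zero])

end Bivector

/-- A skew-symmetric biadditive bracket on `L` with an `R`-linear anchor, satisfying the Leibniz
rule; no Jacobi identity is required. Examples are a Lie algebroid and its deformation by an
arbitrary `(1,1)`-tensor. -/
structure SkewAlgebroid (R L : Type*) [CommRing R] [Algebra ℝ R] [AddCommGroup L] [Module R L] where
  bracket : L → L → L
  anchor : L →ₗ[R] Derivation ℝ R R
  add_bracket : ∀ X X' Y, bracket (X + X') Y = bracket X Y + bracket X' Y
  bracket_add : ∀ X Y Y', bracket X (Y + Y') = bracket X Y + bracket X Y'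
  bracket_self : ∀ X, bracket X X = 0
  leibniz : ∀ (X Y : L) (f : R), bracket X (f • Y) = f • bracket X Y + anchor X f • Y

namespace SkewAlgebroid

variable {R L : Type*} [CommRing R] [Algebra ℝ R] [AddCommGroup L] [Module R L]

theorem bracket_swap (𝒜 : SkewAlgebroid R L) (X Y : L) : 𝒜.bracket X Y = -𝒜.bracket Y X := by
  have h := 𝒜.bracket_self (X + Y)
  rw [𝒜.add_bracket, 𝒜.bracket_add, 𝒜.bracket_add, 𝒜.bracket_self, 𝒜.bracket_self, zero_add,
    add_zero] at h
  exact eq_neg_of_add_eq_zero_left h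

theorem leibniz_left (𝒜 : SkewAlgebroid R L) (X Y : L) (f : R) :
    𝒜.bracket (f • X) Y = f • 𝒜.bracket X Y - 𝒜.anchor Y f • X := by
  rw [𝒜.bracket_swap, 𝒜.leibniz, 𝒜.bracket_swap Y X]
  module

/-- The differential `df` of a function: `(df)(X) = ρ(X) f`. -/
def d₀ (𝒜 : SkewAlgebroid R L) (f : R) : Module.Dual R L where
  toFun X := 𝒜.anchor X f
  map_add' X Y := by simp
  map_smul' g X := by simp

/-- The Lie derivative of a `1`-form: `(𝓛_X α)(Y) = ρ(X)(α(Y)) - α([X, Y])`. -/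
def lieDeriv (𝒜 : SkewAlgebroid R L) (X : L) (α : Module.Dual R L) : Module.Dual R L where
  toFun Y := 𝒜.anchor X (α Y) - α (𝒜.bracket X Y)
  map_add' Y Y' := by simp only [map_add, 𝒜.bracket_add]; ring
  map_smul' f Y := by
    simp only [map_smul, smul_eq_mul, Derivation.leibniz, 𝒜.leibniz, map_add, RingHom.id_apply]
    ring

/-- The differential of a `2`-form. -/
def d₂ (𝒜 : SkewAlgebroid R L) (ω : KForm R L 2) : KForm R L 3 :=
  mkForm₃
    (fun X Y Z => 𝒜.anchor X (ω ![Y, Z]) - 𝒜.anchor Y (ω ![X, Z]) + 𝒜.anchor Z (ω ![X, Y])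
      - ω ![𝒜.bracket X Y, Z] + ω ![𝒜.bracket X Z, Y] - ω ![𝒜.bracket Y Z, X])
    (by
      intros
      simp only [map_add, Derivation.add_apply, 𝒜.add_bracket, 𝒜.bracket_add, ω.add₁, ω.add₂]
      ring)
    (by
      intro c x y z
      simp only [map_smul, Derivation.smul_apply, smul_eq_mul, Derivation.leibniz, 𝒜.leibniz_left,
        𝒜.leibniz, sub_eq_add_neg, ← neg_smul, ω.add₁, ω.add₂, ω.smul₁, ω.smul₂]
      rw [ω.swap₂ x y]
      ring)
    (by
      intros
      simp only [map_add, Derivation.add_apply, 𝒜.add_bracket, 𝒜.bracket_add, ω.add₁, ω.add₂]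
      ring)
    (by
      intro c x y z
      simp only [map_smul, Derivation.smul_apply, smul_eq_mul, Derivation.leibniz, 𝒜.leibniz_left,
        𝒜.leibniz, sub_eq_add_neg, ← neg_smul, ω.add₁, ω.add₂, ω.smul₁, ω.smul₂]
      rw [ω.swap₂ x y]
      ring)
    (by
      intros
      simp only [map_add, Derivation.add_apply, 𝒜.add_bracket, 𝒜.bracket_add, ω.add₁, ω.add₂]
      ring)
    (by
      intro c x y z
      simp only [map_smul, Derivation.smul_apply, smul_eq_mul, Derivation.leibniz, 𝒜.leibniz_left,
        𝒜.leibniz, sub_eq_add_neg, ← neg_smul, ω.add₁, ω.add₂, ω.smul₁, ω.smul₂]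
      rw [ω.swap₂ z y, ω.swap₂ z x]
      ring)
    (by
      intro x z
      have h : ω ![𝒜.bracket x x, z] = 0 := by
        rw [𝒜.bracket_self]
        exact ω.map_coord_zero (m := ![0, z]) 0 rfl
      rw [ω.self₂, map_zero, h]
      ring)
    (by
      intro x y
      have h : ω ![𝒜.bracket y y, x] = 0 := by
        rw [𝒜.bracket_self]
        exact ω.map_coord_zero (m := ![0, x]) 0 rfl
      rw [ω.self₂, map_zero, h]
      ring)
    (by
      intro x y
      have h : ω ![𝒜.bracket x x, y] = 0 := by
        rw [𝒜.bracket_self]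
        exact ω.map_coord_zero (m := ![0, y]) 0 rfl
      have h' : ω ![𝒜.bracket x y, x] + ω ![𝒜.bracket y x, x] = 0 := by
        rw [← ω.add₁, 𝒜.bracket_swap x y, neg_add_cancel]
        exact ω.map_coord_zero (m := ![0, x]) 0 rfl
      rw [ω.self₂, map_zero, h, ω.swap₂ y x, map_neg]
      linear_combination -h')

/-- The differential of a `3`-form, evaluated on four sections. -/
def d₃ (𝒜 : SkewAlgebroid R L) (η : KForm R L 3) (W X Y Z : L) : R :=
  𝒜.anchor W (η ![X, Y, Z]) - 𝒜.anchor X (η ![W, Y, Z])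
    + 𝒜.anchor Y (η ![W, X, Z]) - 𝒜.anchor Z (η ![W, X, Y])
    - η ![𝒜.bracket W X, Y, Z] + η ![𝒜.bracket W Y, X, Z] - η ![𝒜.bracket W Z, X, Y]
    - η ![𝒜.bracket X Y, W, Z] + η ![𝒜.bracket X Z, W, Y] - η ![𝒜.bracket Y Z, W, X]

/-- The deformation by `N`: bracket `[X,Y]_N = [NX,Y] + [X,NY] - N[X,Y]` and anchor `ρ ∘ N`.
Its differential is `d_N`. -/
def deform (𝒜 : SkewAlgebroid R L) (N : L →ₗ[R] L) : SkewAlgebroid R L where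
  bracket X Y := 𝒜.bracket (N X) Y + 𝒜.bracket X (N Y) - N (𝒜.bracket X Y)
  anchor := 𝒜.anchor ∘ₗ N
  add_bracket X X' Y := by simp only [map_add, 𝒜.add_bracket]; abel
  bracket_add X Y Y' := by simp only [map_add, 𝒜.bracket_add]; abel
  bracket_self X := by rw [𝒜.bracket_self, 𝒜.bracket_swap X (N X), map_zero]; abel
  leibniz X Y f := by
    simp only [map_smul, 𝒜.leibniz, map_add, LinearMap.comp_apply]
    module

/-- The Nijenhuis torsion `T_N(X,Y) = [NX,NY] - N([NX,Y] + [X,NY] - N[X,Y])`. -/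
def torsion (𝒜 : SkewAlgebroid R L) (N : L →ₗ[R] L) (X Y : L) : L :=
  𝒜.bracket (N X) (N Y)
    - N (𝒜.bracket (N X) Y + 𝒜.bracket X (N Y) - N (𝒜.bracket X Y))

/-- The bracket `[α,β]_π = 𝓛_{π♯α} β - 𝓛_{π♯β} α - d(π(α,β))` of `1`-forms. -/
def formBracket (𝒜 : SkewAlgebroid R L) (π : Bivector R L) (α β : Module.Dual R L) :
    Module.Dual R L :=
  𝒜.lieDeriv (π.sharp α) β - 𝒜.lieDeriv (π.sharp β) α - 𝒜.d₀ (π.eval α β)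

/-- `C_{π,N} = ([·,·]_N)_π - ([·,·]_π)_{ᵗN}`, where `ᵗN α = α ∘ N`. -/
def concomitant (𝒜 : SkewAlgebroid R L) (π : Bivector R L) (N : L →ₗ[R] L)
    (α β : Module.Dual R L) : Module.Dual R L :=
  (𝒜.deform N).formBracket π α β
    - (𝒜.formBracket π (α ∘ₗ N) β + 𝒜.formBracket π α (β ∘ₗ N) - 𝒜.formBracket π α β ∘ₗ N)

/-- The Schouten-Nijenhuis bracket `[P, Q]` of two bivectors, a trivector, evaluated on three
`1`-forms. See `schouten_wedge` for its value on decomposable bivectors. -/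
def schouten (𝒜 : SkewAlgebroid R L) (P Q : Bivector R L) (α β γ : Module.Dual R L) : R :=
  (𝒜.lieDeriv (P.sharp α) β (Q.sharp γ) + 𝒜.lieDeriv (Q.sharp α) β (P.sharp γ))
  + (𝒜.lieDeriv (P.sharp β) γ (Q.sharp α) + 𝒜.lieDeriv (Q.sharp β) γ (P.sharp α))
  + (𝒜.lieDeriv (P.sharp γ) α (Q.sharp β) + 𝒜.lieDeriv (Q.sharp γ) α (P.sharp β))

/-- The Schouten-Nijenhuis bracket satisfies
`[X∧Y, Z∧W] = [X,Z]∧Y∧W - [X,W]∧Y∧Z - [Y,Z]∧X∧W + [Y,W]∧X∧Z`. -/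
theorem schouten_wedge (𝒜 : SkewAlgebroid R L) (X Y Z W : L) (α β γ : Module.Dual R L) :
    let tri : L → L → L → R := fun A B C =>
      Matrix.det !![α A, α B, α C; β A, β B, β C; γ A, γ B, γ C]
    𝒜.schouten (.wedge X Y) (.wedge Z W) α β γ =
      tri (𝒜.bracket X Z) Y W - tri (𝒜.bracket X W) Y Z
        - tri (𝒜.bracket Y Z) X W + tri (𝒜.bracket Y W) X Z := by
  simp only [schouten, lieDeriv, Bivector.wedge, LinearMap.coe_mk, AddHom.coe_mk,
    Matrix.det_fin_three, Matrix.of_apply, Matrix.cons_val]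
  simp only [sub_eq_add_neg, ← neg_smul, 𝒜.add_bracket, 𝒜.bracket_add, 𝒜.leibniz, 𝒜.leibniz_left,
    map_add, map_smul, map_neg, Derivation.leibniz, smul_eq_mul, Derivation.add_apply,
    Derivation.smul_apply, 𝒜.bracket_swap Z X, 𝒜.bracket_swap Z Y, 𝒜.bracket_swap W X,
    𝒜.bracket_swap W Y]
  ring

/-- `π` is a Poisson bivector: `[π, π] = 0`. -/
def IsPoisson (𝒜 : SkewAlgebroid R L) (π : Bivector R L) : Prop :=
  ∀ α β γ : Module.Dual R L, 𝒜.schouten π π α β γ = 0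

/-- `(π, N, ψ, H)` is a Poisson quasi-Nijenhuis structure with background. The signs of
`concomitant_eq` and `torsion_eq` are those of the big bracket form of the definition. -/
structure IsPoissonQuasiNijenhuisWithBackground (𝒜 : SkewAlgebroid R L) (π : Bivector R L) (N : L →ₗ[R] L)
    (ψ H : KForm R L 3) : Prop where
  /-- `N ∘ π♯ = π♯ ∘ ᵗN` -/
  comm : ∀ α : Module.Dual R L, N (π.sharp α) = π.sharp (α ∘ₗ N)
  closed_psi : ∀ W X Y Z : L, 𝒜.d₃ ψ W X Y Z = 0
  closed_background : ∀ W X Y Z : L, 𝒜.d₃ H W X Y Z = 0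
  poisson : 𝒜.IsPoisson π
  /-- `C_{π,N}(α,β) = 2 H(π♯α, π♯β, ·)` -/
  concomitant_eq : ∀ α β : Module.Dual R L,
    𝒜.concomitant π N α β = (2 : R) • contract H (π.sharp α) (π.sharp β)
  /-- `T_N(X,Y) = -π♯(H(NX,Y,·) - H(NY,X,·) + ψ(X,Y,·))` -/
  torsion_eq : ∀ X Y : L,
    𝒜.torsion N X Y =
      -π.sharp (contract H (N X) Y - contract H (N Y) X + contract ψ X Y)
  /-- `d_N ψ = d𝓗` -/
  differential_eq : ∀ W X Y Z : L,
    (𝒜.deform N).d₃ ψ W X Y Z = 𝒜.d₃ (cyclicForm N H) W X Y Z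

end SkewAlgebroid

/-!
# Lie algebroids over a smooth manifold
-/

section Geometry

open scoped ContDiff

variable {E : Type*} [NormedAddCommGroup E] [NormedSpace ℝ E]
  {M : Type*} [TopologicalSpace M] [ChartedSpace E M]
  {F : Type*} [NormedAddCommGroup F] [NormedSpace ℝ F]
  {A : M → Type*} [TopologicalSpace (Bundle.TotalSpace F A)] [∀ x, TopologicalSpace (A x)]
  [FiberBundle F A] [∀ x, AddCommGroup (A x)] [∀ x, Module ℝ (A x)] [VectorBundle ℝ F A]

/-- The ring `C^∞(M)`. -/
abbrev Fun (E M : Type*) [NormedAddCommGroup E] [NormedSpace ℝ E] [TopologicalSpace M]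
    [ChartedSpace E M] : Type _ :=
  C^∞⟮𝓘(ℝ, E), M; ℝ⟯

/-- The smooth sections `Γ(A)` of the vector bundle `A → M` with model fibre `F`. -/
abbrev Sec (E F : Type*) {M : Type*} [NormedAddCommGroup E] [NormedSpace ℝ E]
    [TopologicalSpace M] [ChartedSpace E M] [NormedAddCommGroup F] [NormedSpace ℝ F]
    (A : M → Type*) [TopologicalSpace (Bundle.TotalSpace F A)] [∀ x, TopologicalSpace (A x)]
    [FiberBundle F A] : Type _ :=
  Cₛ^∞⟮𝓘(ℝ, E); F, A⟯

theorem Fun.mdifferentiableAt (f : Fun E M) (x : M) :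
    MDifferentiableAt 𝓘(ℝ, E) 𝓘(ℝ, ℝ) f x :=
  f.contMDiff.mdifferentiableAt (by simp)

/-- Pointwise multiplication of a section by a function. -/
instance : SMul (Fun E M) (Sec E F A) :=
  ⟨fun f s => ⟨fun x => f x • s x, ContMDiff.smul_section f.contMDiff s.contMDiff⟩⟩

theorem Sec.smul_apply (f : Fun E M) (s : Sec E F A) (x : M) : (f • s) x = f x • s x := rfl

instance : Module (Fun E M) (Sec E F A) where
  smul_add c f g := by ext x; exact smul_add (c x) (f x) (g x)
  add_smul c₁ c₂ f := by ext x; exact add_smul (c₁ x) (c₂ x) (f x)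
  mul_smul c₁ c₂ f := by ext x; exact mul_smul (c₁ x) (c₂ x) (f x)
  one_smul f := by ext x; exact one_smul ℝ (f x)
  zero_smul f := by ext x; exact zero_smul ℝ (f x)
  smul_zero r := by ext x; exact smul_zero (r x)

/-- A smooth vector bundle morphism `A → TM` over the identity of `M`. -/
structure Anchor (E F : Type*) {M : Type*} [NormedAddCommGroup E] [NormedSpace ℝ E]
    [TopologicalSpace M] [ChartedSpace E M] [IsManifold 𝓘(ℝ, E) ∞ M]
    [NormedAddCommGroup F] [NormedSpace ℝ F]
    (A : M → Type*) [TopologicalSpace (Bundle.TotalSpace F A)] [∀ x, TopologicalSpace (A x)]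
    [FiberBundle F A] [∀ x, AddCommGroup (A x)] [∀ x, Module ℝ (A x)] [VectorBundle ℝ F A] where
  toFun : ∀ x : M, A x →ₗ[ℝ] TangentSpace 𝓘(ℝ, E) x
  smooth : ContMDiff (𝓘(ℝ, E).prod 𝓘(ℝ, F)) 𝓘(ℝ, E).tangent ∞
    (fun v : Bundle.TotalSpace F A => (⟨v.proj, toFun v.proj v.snd⟩ : TangentBundle 𝓘(ℝ, E) M))

variable [IsManifold 𝓘(ℝ, E) ∞ M]

/-- The function `ρ(X) f`, whose value at `x` is `df_x (ρ_x (X_x))`. -/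
def Anchor.apply (ρ : Anchor E F A) (X : Sec E F A) (f : Fun E M) : Fun E M where
  val x := mvfderiv 𝓘(ℝ, E) f x (ρ.toFun x (X x))
  property := by
    have h₁ := ρ.smooth.comp X.contMDiff
    have h₂ := (f.contMDiff.contMDiff_tangentMap (m := ∞) (by simp)).comp h₁
    exact (contMDiff_snd_tangentBundle_modelSpace ℝ 𝓘(ℝ, ℝ)).comp h₂

theorem Anchor.apply_apply (ρ : Anchor E F A) (X : Sec E F A) (f : Fun E M) (x : M) :
    ρ.apply X f x = mvfderiv 𝓘(ℝ, E) f x (ρ.toFun x (X x)) := rfl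

/-- The action of the sections of `A` on functions through the anchor. -/
def Anchor.deriv (ρ : Anchor E F A) : Sec E F A →ₗ[Fun E M] Derivation ℝ (Fun E M) (Fun E M) where
  toFun X := Derivation.mk'
    { toFun := ρ.apply X
      map_add' := fun f g => by
        ext x
        have h := mvfderiv_add (f.mdifferentiableAt x) (g.mdifferentiableAt x)
        exact congrArg (fun T => T (ρ.toFun x (X x))) h
      map_smul' := fun c f => by
        ext x
        have h : mvfderiv 𝓘(ℝ, E) (fun y => c • f y) x = c • mvfderiv 𝓘(ℝ, E) f x := by
          have := mvfderiv_smul (mdifferentiableAt_const (c := c)) (f.mdifferentiableAt x)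
          rw [mvfderiv_const] at this
          simpa using! this
        exact congrArg (fun T => T (ρ.toFun x (X x))) h }
    (fun f g => by
      ext x
      have h := mvfderiv_mul (f.mdifferentiableAt x) (g.mdifferentiableAt x)
      exact congrArg (fun T => T (ρ.toFun x (X x))) h)
  map_add' X Y := by
    ext f x
    change mvfderiv 𝓘(ℝ, E) f x (ρ.toFun x (X x + Y x)) = _
    rw [map_add, map_add]
    rfl
  map_smul' g X := by
    ext f x
    change mvfderiv 𝓘(ℝ, E) f x (ρ.toFun x (g x • X x)) = _
    rw [map_smul, map_smul]
    rfl

/-- A Lie algebroid structure on the vector bundle `A → M`: a Lie bracket on `Γ(A)` and an anchor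
`A → TM` which satisfy the Leibniz rule, the anchor being compatible with the brackets of sections
and of vector fields (viewed as derivations of `C^∞(M)`). -/
structure LieAlgebroid (E F : Type*) {M : Type*} [NormedAddCommGroup E] [NormedSpace ℝ E]
    [TopologicalSpace M] [ChartedSpace E M] [IsManifold 𝓘(ℝ, E) ∞ M]
    [NormedAddCommGroup F] [NormedSpace ℝ F]
    (A : M → Type*) [TopologicalSpace (Bundle.TotalSpace F A)] [∀ x, TopologicalSpace (A x)]
    [FiberBundle F A] [∀ x, AddCommGroup (A x)] [∀ x, Module ℝ (A x)] [VectorBundle ℝ F A] where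
  bracket : Sec E F A → Sec E F A → Sec E F A
  anchor : Anchor E F A
  add_bracket : ∀ X X' Y, bracket (X + X') Y = bracket X Y + bracket X' Y
  bracket_add : ∀ X Y Y', bracket X (Y + Y') = bracket X Y + bracket X Y'
  bracket_self : ∀ X, bracket X X = 0
  jacobi : ∀ X Y Z,
    bracket X (bracket Y Z) + bracket Y (bracket Z X) + bracket Z (bracket X Y) = 0
  leibniz : ∀ (X Y : Sec E F A) (f : Fun E M),
    bracket X (f • Y) = f • bracket X Y + anchor.deriv X f • Y
  anchor_bracket : ∀ X Y, anchor.deriv (bracket X Y) = ⁅anchor.deriv X, anchor.deriv Y⁆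

/-- The bracket and the anchor of a Lie algebroid, on the `C^∞(M)`-module `Γ(A)`. -/
def LieAlgebroid.toSkew (𝒜 : LieAlgebroid E F A) : SkewAlgebroid (Fun E M) (Sec E F A) where
  bracket := 𝒜.bracket
  anchor := 𝒜.anchor.deriv
  add_bracket := 𝒜.add_bracket
  bracket_add := 𝒜.bracket_add
  bracket_self := 𝒜.bracket_self
  leibniz := 𝒜.leibniz

end Geometry

end PqN

end

/-! The Poisson condition enters only through the cyclic identity `IsPoisson.lieDeriv_cyclic`,
(𝓛_{π♯α} β)(π♯γ) + cyclic = 0. Since π♯(ω♭X) = NX, substituting forms ω♭X for some of the arguments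
turns it into the identities about N: one substitution gives the formula for C_{π,N}
(`IsPoisson.concomitant_endo`), two give the torsion (`IsPoisson.torsion_endo`), three give i_N dω_N
+ 𝓗 = d(ω(N·,N·)) (`IsPoisson.insertForm_add_cyclicForm`). Skewness of π supplies the algebra: α ∘ N
= ω♭(π♯α), hence ω(X,NY) = ω(NX,Y).

The last condition is then formal. By `deform_d₃`, d_N = i_N d - d i_N; as ψ = dω_N is closed, d_N ψ
= -d(i_N ψ). Since i_N ψ + 𝓗 is exact and d² = 0 (`d₃_d₂`), this equals d𝓗.

The torsion formula is an equality of sections, proved by pairing with arbitrary 1-forms;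
`Sec.eq_zero_of_forall_dual` provides enough of them by means of bump functions. -/

namespace PqN

/-! ### Signs of alternating forms and the insertion operator i_N. -/

section Forms

variable {R L : Type*} [CommRing R] [AddCommGroup L] [Module R L]

theorem KForm.neg₁ (η : KForm R L 2) (x y : L) : η ![-x, y] = -η ![x, y] := by
  rw [← neg_one_smul R x, η.smul₁, neg_one_mul]

theorem KForm.neg₃₁ (η : KForm R L 3) (x y z : L) : η ![-x, y, z] = -η ![x, y, z] := by
  rw [← neg_one_smul R x, η.smul₃₁, neg_one_mul]

theorem KForm.swap₃₁₂ (η : KForm R L 3) (x y z : L) : η ![x, y, z] = -η ![y, x, z] := by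
  have h := η.self₃₁₂ (x + y) z
  rw [η.add₃₁, η.add₃₂, η.add₃₂, η.self₃₁₂, η.self₃₁₂] at h
  linear_combination h

theorem KForm.swap₃₂₃ (η : KForm R L 3) (x y z : L) : η ![x, y, z] = -η ![x, z, y] := by
  have h := η.self₃₂₃ x (y + z)
  rw [η.add₃₂, η.add₃₃, η.add₃₃, η.self₃₂₃, η.self₃₂₃] at h
  linear_combination h

theorem KForm.swap₃₁₃ (η : KForm R L 3) (x y z : L) : η ![x, y, z] = -η ![z, y, x] := by
  rw [η.swap₃₁₂, η.swap₃₂₃, η.swap₃₁₂, neg_neg]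

/-- The derivation `i_N` of degree `0` on `3`-forms:
`(i_N η)(X,Y,Z) = η(NX,Y,Z) + η(X,NY,Z) + η(X,Y,NZ)`. -/
def insertForm (N : L →ₗ[R] L) (η : KForm R L 3) : KForm R L 3 :=
  mkForm₃ (fun X Y Z => η ![N X, Y, Z] + η ![X, N Y, Z] + η ![X, Y, N Z])
    (by intros; simp only [map_add, η.add₃₁]; ring)
    (by intros; simp only [map_smul, η.smul₃₁]; ring)
    (by intros; simp only [map_add, η.add₃₂]; ring)
    (by intros; simp only [map_smul, η.smul₃₂]; ring)
    (by intros; simp only [map_add, η.add₃₃]; ring)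
    (by intros; simp only [map_smul, η.smul₃₃]; ring)
    (by intro x z; rw [η.self₃₁₂, η.swap₃₁₂ (N x)]; ring)
    (by intro x z; rw [η.self₃₂₃, η.swap₃₂₃ x (N z)]; ring)
    (by intro x z; rw [η.self₃₁₃, η.swap₃₁₃ (N x)]; ring)

theorem insertForm_apply (N : L →ₗ[R] L) (η : KForm R L 3) (X Y Z : L) :
    insertForm N η ![X, Y, Z] = η ![N X, Y, Z] + η ![X, N Y, Z] + η ![X, Y, N Z] := rfl

theorem cyclicForm_apply (N : L →ₗ[R] L) (H : KForm R L 3) (X Y Z : L) :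
    cyclicForm N H ![X, Y, Z] = H ![N X, N Y, Z] + H ![N Y, N Z, X] + H ![N Z, N X, Y] := rfl

theorem contract_apply (η : KForm R L 3) (X Y Z : L) : contract η X Y Z = η ![X, Y, Z] := rfl

theorem flat_apply (ω : KForm R L 2) (X Y : L) : flat ω X Y = ω ![X, Y] := rfl

end Forms

/-! ### Algebra of N = π♯ ∘ ω♭ relative to ω. -/

namespace Bivector

variable {R L : Type*} [CommRing R] [AddCommGroup L] [Module R L]

theorem endo_apply (π : Bivector R L) (ω : KForm R L 2) (X : L) :
    π.endo ω X = π.sharp (flat ω X) := rfl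

theorem twistedForm_apply (π : Bivector R L) (ω : KForm R L 2) (X Y : L) :
    π.twistedForm ω ![X, Y] = ω ![π.endo ω X, Y] := rfl

/-- Skewness of π moves π♯ from ω♭X onto α. In the computations below this removes N from inside
every pairing with a 1-form. -/
theorem apply_endo (π : Bivector R L) (ω : KForm R L 2) (α : Module.Dual R L) (X : L) :
    α (π.endo ω X) = ω ![π.sharp α, X] := by
  rw [endo_apply, π.eval_swap, flat_apply, ← ω.swap₂]

theorem dual_comp_endo (π : Bivector R L) (ω : KForm R L 2) (α : Module.Dual R L) :
    α ∘ₗ π.endo ω = flat ω (π.sharp α) :=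
  LinearMap.ext fun X => π.apply_endo ω α X

/-- The case α = ω♭X of `apply_endo`: N is symmetric for ω, so every power of N can be shifted to
one slot and terms become comparable. -/
theorem endo_right (π : Bivector R L) (ω : KForm R L 2) (X Y : L) :
    ω ![X, π.endo ω Y] = ω ![π.endo ω X, Y] :=
  π.apply_endo ω (flat ω X) Y

/-- The `2`-form `ω(N²X, Y) = ω(NX, NY)`, where `N = π♯ ∘ ω♭`. -/
def twistedForm₂ (π : Bivector R L) (ω : KForm R L 2) : KForm R L 2 :=
  mkForm₂ (fun X Y => ω ![π.endo ω X, π.endo ω Y])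
    (by intros; simp only [map_add, ω.add₁]) (by intros; simp only [map_smul, ω.smul₁])
    (by intros; simp only [map_add, ω.add₂]) (by intros; simp only [map_smul, ω.smul₂])
    (fun _ => ω.self₂ _)

theorem twistedForm₂_apply (π : Bivector R L) (ω : KForm R L 2) (X Y : L) :
    π.twistedForm₂ ω ![X, Y] = ω ![π.endo ω X, π.endo ω Y] := rfl

end Bivector

/-! ### The differentials d and d_N, and the Poisson identity. -/

namespace SkewAlgebroid

variable {R L : Type*} [CommRing R] [Algebra ℝ R] [AddCommGroup L] [Module R L]

theorem d₂_apply (𝒜 : SkewAlgebroid R L) (ω : KForm R L 2) (X Y Z : L) :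
    𝒜.d₂ ω ![X, Y, Z] =
      𝒜.anchor X (ω ![Y, Z]) - 𝒜.anchor Y (ω ![X, Z]) + 𝒜.anchor Z (ω ![X, Y])
        - ω ![𝒜.bracket X Y, Z] + ω ![𝒜.bracket X Z, Y] - ω ![𝒜.bracket Y Z, X] := rfl

theorem lieDeriv_apply (𝒜 : SkewAlgebroid R L) (X : L) (α : Module.Dual R L) (Y : L) :
    𝒜.lieDeriv X α Y = 𝒜.anchor X (α Y) - α (𝒜.bracket X Y) := rfl

theorem d₀_apply (𝒜 : SkewAlgebroid R L) (f : R) (X : L) : 𝒜.d₀ f X = 𝒜.anchor X f := rfl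

theorem deform_bracket (𝒜 : SkewAlgebroid R L) (N : L →ₗ[R] L) (X Y : L) :
    (𝒜.deform N).bracket X Y = 𝒜.bracket (N X) Y + 𝒜.bracket X (N Y) - N (𝒜.bracket X Y) := rfl

theorem deform_anchor (𝒜 : SkewAlgebroid R L) (N : L →ₗ[R] L) (X : L) :
    (𝒜.deform N).anchor X = 𝒜.anchor (N X) := rfl

theorem d₃_add (𝒜 : SkewAlgebroid R L) (η θ : KForm R L 3) (W X Y Z : L) :
    𝒜.d₃ (η + θ) W X Y Z = 𝒜.d₃ η W X Y Z + 𝒜.d₃ θ W X Y Z := by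
  simp only [d₃, AlternatingMap.add_apply, map_add]
  ring

theorem d₃_neg (𝒜 : SkewAlgebroid R L) (η : KForm R L 3) (W X Y Z : L) :
    𝒜.d₃ (-η) W X Y Z = -𝒜.d₃ η W X Y Z := by
  simp only [d₃, AlternatingMap.neg_apply, map_neg]
  ring

/-- `d ∘ d = 0` on `2`-forms. -/
theorem d₃_d₂ (𝒜 : SkewAlgebroid R L)
    (jacobi : ∀ X Y Z, 𝒜.bracket X (𝒜.bracket Y Z) + 𝒜.bracket Y (𝒜.bracket Z X)
      + 𝒜.bracket Z (𝒜.bracket X Y) = 0)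
    (anchor_bracket : ∀ X Y, 𝒜.anchor (𝒜.bracket X Y) = ⁅𝒜.anchor X, 𝒜.anchor Y⁆)
    (ω : KForm R L 2) (W X Y Z : L) : 𝒜.d₃ (𝒜.d₂ ω) W X Y Z = 0 := by
  -- The Jacobi identity with every inner bracket on the left, the shape in which iterated brackets
  -- occur in the first slot of ω.
  have jac : ∀ X Y Z V : L, ω ![𝒜.bracket (𝒜.bracket X Y) Z, V]
      - ω ![𝒜.bracket (𝒜.bracket X Z) Y, V] + ω ![𝒜.bracket (𝒜.bracket Y Z) X, V] = 0 := by
    intro X Y Z V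
    have h0 : ω ![(0 : L), V] = 0 := ω.map_coord_zero (m := ![0, V]) 0 rfl
    have h : 𝒜.bracket (𝒜.bracket X Y) Z + -𝒜.bracket (𝒜.bracket X Z) Y
        + 𝒜.bracket (𝒜.bracket Y Z) X = 0 := by
      have hn : 𝒜.bracket Y (𝒜.bracket Z X) = 𝒜.bracket (𝒜.bracket X Z) Y := by
        rw [𝒜.bracket_swap Y, 𝒜.bracket_swap Z X]
        -- The bracket is only assumed additive, so its compatibility with negation is deduced from
        -- additivity.
        have := 𝒜.add_bracket (𝒜.bracket X Z) (-𝒜.bracket X Z) Y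
        have h00 := 𝒜.add_bracket 0 0 Y
        rw [add_neg_cancel] at this
        simp only [add_zero, left_eq_add] at h00
        rw [h00] at this
        exact (eq_neg_of_add_eq_zero_left this.symm).symm
      have := jacobi X Y Z
      rw [hn, 𝒜.bracket_swap X, 𝒜.bracket_swap Z] at this
      rw [← neg_eq_zero, ← this]
      abel
    rw [← h, ω.add₁, ω.add₁, ω.neg₁] at h0
    linear_combination h0
  simp only [d₃, d₂_apply, map_add, map_sub, anchor_bracket, Derivation.commutator_apply]
  -- Each pairing of two brackets occurs twice, once in either order, and cancels by skewness of ω.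
  -- The second-order anchor terms cancel as commutators, leaving one Jacobi sum for each choice of
  -- three of the four sections.
  rw [ω.swap₂ (𝒜.bracket W X) (𝒜.bracket Y Z), ω.swap₂ (𝒜.bracket W Y) (𝒜.bracket X Z),
    ω.swap₂ (𝒜.bracket W Z) (𝒜.bracket X Y)]
  linear_combination jac W X Y Z - jac W X Z Y + jac W Y Z X - jac X Y Z W

/-- `d_N = i_N ∘ d - d ∘ i_N` on `3`-forms. -/
theorem deform_d₃ (𝒜 : SkewAlgebroid R L) (N : L →ₗ[R] L) (η : KForm R L 3) (W X Y Z : L) :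
    (𝒜.deform N).d₃ η W X Y Z =
      𝒜.d₃ η (N W) X Y Z + 𝒜.d₃ η W (N X) Y Z + 𝒜.d₃ η W X (N Y) Z + 𝒜.d₃ η W X Y (N Z)
        - 𝒜.d₃ (insertForm N η) W X Y Z := by
  -- Plain expansion, with no Jacobi identity: the terms η(N[·,·],·,·) in d_N η come from -d(i_N η),
  -- and those with N in an outer slot cancel against the same terms of i_N(dη).
  simp only [d₃, insertForm_apply, deform_bracket, deform_anchor, map_add, η.add₃₁,
    sub_eq_add_neg, η.neg₃₁]
  ring

/-- For P = Q the Schouten bracket lists each cyclic term twice; 2 is invertible because R is a real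
algebra. -/
theorem IsPoisson.lieDeriv_cyclic {𝒜 : SkewAlgebroid R L} {π : Bivector R L}
    (hπ : 𝒜.IsPoisson π) (α β γ : Module.Dual R L) :
    𝒜.lieDeriv (π.sharp α) β (π.sharp γ) + 𝒜.lieDeriv (π.sharp β) γ (π.sharp α)
      + 𝒜.lieDeriv (π.sharp γ) α (π.sharp β) = 0 := by
  have h := hπ α β γ
  rw [schouten] at h
  have h2 : (algebraMap ℝ R 2⁻¹) * 2 = 1 := by
    rw [← map_ofNat (algebraMap ℝ R) 2, ← map_mul]
    norm_num
  linear_combination (algebraMap ℝ R 2⁻¹) * h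
    - (𝒜.lieDeriv (π.sharp α) β (π.sharp γ) + 𝒜.lieDeriv (π.sharp β) γ (π.sharp α)
      + 𝒜.lieDeriv (π.sharp γ) α (π.sharp β)) * h2

end SkewAlgebroid

theorem Bivector.endo_swap {R L : Type*} [CommRing R] [AddCommGroup L] [Module R L]
    (π : Bivector R L) (ω : KForm R L 2) (X Y : L) :
    ω ![π.endo ω X, Y] = -ω ![π.endo ω Y, X] := by
  rw [← π.endo_right, ω.swap₂]

/-! ### Consequences of the Poisson identity for N. -/

namespace SkewAlgebroid

variable {R L : Type*} [CommRing R] [Algebra ℝ R] [AddCommGroup L] [Module R L]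

/-- For a Poisson bivector, `π♯` intertwines the brackets, up to elements annihilated by the
dual. -/
theorem IsPoisson.apply_bracket_sharp {𝒜 : SkewAlgebroid R L} {π : Bivector R L}
    (hπ : 𝒜.IsPoisson π) (α β γ : Module.Dual R L) :
    γ (𝒜.bracket (π.sharp α) (π.sharp β)) = γ (π.sharp (𝒜.formBracket π α β)) := by
  have h := hπ.lieDeriv_cyclic α β γ
  rw [π.eval_swap]
  simp only [formBracket, lieDeriv_apply, d₀_apply, LinearMap.sub_apply, Bivector.eval] at h ⊢
  rw [𝒜.bracket_swap (π.sharp β) (π.sharp α), 𝒜.bracket_swap (π.sharp γ) (π.sharp β),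
    π.eval_swap α γ, π.eval_swap β α] at h
  simp only [map_neg] at h
  linear_combination h

/-- `C_{π,N}(α,β) = -2 dω(π♯α, π♯β, ·)` for `N = π♯ ∘ ω♭`. -/
theorem IsPoisson.concomitant_endo {𝒜 : SkewAlgebroid R L} {π : Bivector R L} (hπ : 𝒜.IsPoisson π)
    (ω : KForm R L 2) (α β : Module.Dual R L) :
    𝒜.concomitant π (π.endo ω) α β =
      (2 : R) • contract (-𝒜.d₂ ω) (π.sharp α) (π.sharp β) := by
  ext X
  -- In C_{π,N}(α,β)(X) the terms along Nπ♯α and Nπ♯β cancel, while the derivative and the brackets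
  -- along NX occur twice. The cyclic identity for (α, ω♭X, β) trades these for terms of dω, whence
  -- the factor 2.
  have h := hπ.lieDeriv_cyclic α (flat ω X) β
  simp only [concomitant, formBracket, Bivector.eval,
    lieDeriv_apply, d₀_apply, deform_bracket, deform_anchor, LinearMap.sub_apply,
    LinearMap.add_apply, LinearMap.smul_apply, LinearMap.comp_apply, contract_apply,
    AlternatingMap.neg_apply, d₂_apply, smul_eq_mul, map_add, map_sub] at h ⊢
  simp only [π.dual_comp_endo, ← π.endo_apply, π.apply_endo, flat_apply] at h ⊢
  rw [𝒜.bracket_swap (π.endo ω X) (π.sharp α), ω.swap₂ X (π.sharp β),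
    ω.swap₂ X (𝒜.bracket _ _)] at h
  rw [ω.swap₂ (π.sharp β) (π.sharp α), ω.swap₂ (𝒜.bracket (π.sharp α) X),
    ω.swap₂ (𝒜.bracket (π.sharp β) X)]
  simp only [map_neg] at h ⊢
  linear_combination -2 * h

/-- The torsion of `N = π♯ ∘ ω♭`, when the dual of `L` separates points. -/
theorem IsPoisson.torsion_endo {𝒜 : SkewAlgebroid R L} {π : Bivector R L} (hπ : 𝒜.IsPoisson π)
    (sep : ∀ X : L, (∀ α : Module.Dual R L, α X = 0) → X = 0)
    (ω : KForm R L 2) (X Y : L) :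
    𝒜.torsion (π.endo ω) X Y =
      -π.sharp (contract (-𝒜.d₂ ω) (π.endo ω X) Y - contract (-𝒜.d₂ ω) (π.endo ω Y) X
        + contract (𝒜.d₂ (π.twistedForm ω)) X Y) := by
  rw [← sub_eq_zero]
  refine sep _ fun γ => ?_
  rw [map_sub, map_neg, π.eval_swap _ γ, neg_neg]
  -- Here [NX,NY] is [π♯(ω♭X), π♯(ω♭Y)], hence π♯ of the bracket of the two forms ω♭X and ω♭Y.
  -- Moving π♯ onto γ makes both sides expressions evaluated at π♯γ.
  have h := hπ.apply_bracket_sharp (flat ω X) (flat ω Y) γ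
  rw [π.eval_swap _ γ] at h
  simp only [torsion, formBracket, ← π.endo_apply, Bivector.eval,
    lieDeriv_apply, d₀_apply, LinearMap.sub_apply,
    LinearMap.add_apply, contract_apply,
    AlternatingMap.neg_apply, d₂_apply, flat_apply, map_add, map_sub,
    π.apply_endo, π.twistedForm_apply, π.endo_right] at h ⊢
  rw [ω.swap₂ Y (𝒜.bracket _ _), ω.swap₂ X (𝒜.bracket _ _)] at h
  rw [ω.swap₂ (π.sharp γ) (𝒜.bracket (π.endo ω X) Y),
    ω.swap₂ (π.sharp γ) (𝒜.bracket X (π.endo ω Y)), π.endo_swap ω (π.sharp γ),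
    𝒜.bracket_swap X (π.endo ω Y), ω.neg₁]
  rw [π.endo_swap ω Y X] at h ⊢
  simp only [map_neg] at h ⊢
  linear_combination h

/-- `i_N dω_N + 𝓗 = d(ω(N·, N·))`, where `𝓗` is the cyclic form of `-dω`. -/
theorem IsPoisson.insertForm_add_cyclicForm {𝒜 : SkewAlgebroid R L} {π : Bivector R L}
    (hπ : 𝒜.IsPoisson π) (ω : KForm R L 2) :
    insertForm (π.endo ω) (𝒜.d₂ (π.twistedForm ω)) + cyclicForm (π.endo ω) (-𝒜.d₂ ω) =
      𝒜.d₂ (π.twistedForm₂ ω) := by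
  ext v
  obtain ⟨X, Y, Z, rfl⟩ : ∃ X Y Z, v = ![X, Y, Z] :=
    ⟨v 0, v 1, v 2, by ext i; fin_cases i <;> rfl⟩
  -- With three forms ω♭ the identity involves only ω, N and brackets of NX, NY, NZ, which are
  -- exactly the terms left over after expanding the three differentials.
  have h := hπ.lieDeriv_cyclic (flat ω X) (flat ω Y) (flat ω Z)
  simp only [← π.endo_apply, lieDeriv_apply, AlternatingMap.add_apply, insertForm_apply,
    cyclicForm_apply, AlternatingMap.neg_apply, d₂_apply, flat_apply,
    π.twistedForm_apply, π.twistedForm₂_apply, π.endo_right] at h ⊢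
  rw [𝒜.bracket_swap (π.endo ω Y) X, 𝒜.bracket_swap (π.endo ω Z) X,
    𝒜.bracket_swap (π.endo ω Z) Y, 𝒜.bracket_swap (π.endo ω Z) (π.endo ω X)]
  rw [ω.swap₂ Y (𝒜.bracket _ _), ω.swap₂ Z (𝒜.bracket _ _), ω.swap₂ X (𝒜.bracket _ _),
    𝒜.bracket_swap (π.endo ω Y) (π.endo ω X), 𝒜.bracket_swap (π.endo ω Z) (π.endo ω Y)] at h
  rw [π.endo_swap ω Z X] at h ⊢
  rw [π.endo_swap ω Y X, π.endo_swap ω Z Y, π.endo_swap ω (π.endo ω Z) X, π.endo_right]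
  simp only [map_neg, ω.neg₁] at h ⊢
  linear_combination -h

end SkewAlgebroid

/-! ### Enough global 1-forms on a vector bundle. -/

open scoped ContDiff

/-- The sections of the dual bundle separate the smooth sections of a vector bundle. -/
theorem Sec.eq_zero_of_forall_dual
    {E : Type*} [NormedAddCommGroup E] [NormedSpace ℝ E] [FiniteDimensional ℝ E]
    {M : Type*} [TopologicalSpace M] [T2Space M] [ChartedSpace E M] [IsManifold 𝓘(ℝ, E) ∞ M]
    {F : Type*} [NormedAddCommGroup F] [NormedSpace ℝ F]
    {A : M → Type*} [TopologicalSpace (Bundle.TotalSpace F A)] [∀ x, TopologicalSpace (A x)]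
    [FiberBundle F A] [∀ x, AddCommGroup (A x)] [∀ x, Module ℝ (A x)] [VectorBundle ℝ F A]
    [ContMDiffVectorBundle ∞ F A 𝓘(ℝ, E)] (X : Sec E F A)
    (h : ∀ α : Module.Dual (Fun E M) (Sec E F A), α X = 0) : X = 0 := by
  ext x
  set e := trivializationAt F A x
  have hx : x ∈ e.baseSet := FiberBundle.mem_baseSet_trivializationAt' x
  -- Only the existence of a bump function centred at x with closed support in the trivializing set
  -- is needed, hence the trivial neighbourhood `univ`.
  obtain ⟨χ, hχ, -⟩ := (SmoothBumpFunction.nhds_basis_support (I := 𝓘(ℝ, E))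
    (e.open_baseSet.mem_nhds hx)).mem_iff.1 (Filter.univ_mem)
  refine (e.continuousLinearEquivAt ℝ x hx).map_eq_zero_iff.1 ?_
  refine SeparatingDual.eq_zero_of_forall_dual_eq_zero (R := ℝ) fun φ => ?_
  -- A functional φ on the model fibre, read in the trivialization and cut off by χ, becomes a
  -- global 1-form. Since χ is 1 at x, its value there is φ applied to X in the trivialization.
  let ev : Sec E F A → M → ℝ := fun Y y => χ y * φ (e.linearMapAt ℝ y (Y y))
  have smooth : ∀ Y, ContMDiff 𝓘(ℝ, E) 𝓘(ℝ, ℝ) ∞ (ev Y) := by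
    intro Y
    -- Smoothness is required only on the closed support, which lies inside the trivializing set.
    refine contMDiff_of_tsupport fun y hy => ?_
    have hy' : y ∈ e.baseSet := hχ (tsupport_mul_subset_left hy)
    have h₁ : ContMDiffAt 𝓘(ℝ, E) 𝓘(ℝ, F) ∞ (fun z => (e ⟨z, Y z⟩).2) y :=
      (e.contMDiffAt_section_iff hy').1 (Y.contMDiff y)
    have h₂ : ContMDiffAt 𝓘(ℝ, E) 𝓘(ℝ, ℝ) ∞ (fun z => χ z * φ (e ⟨z, Y z⟩).2) y :=
      χ.contMDiffAt.mul (φ.contMDiff.contMDiffAt.comp y h₁)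
    refine h₂.congr_of_eventuallyEq ?_
    filter_upwards [e.open_baseSet.mem_nhds hy'] with z hz
    simp only [ev, e.coe_linearMapAt_of_mem (R := ℝ) hz]
  let α : Module.Dual (Fun E M) (Sec E F A) :=
    { toFun := fun Y => ⟨ev Y, smooth Y⟩
      map_add' := fun Y Z => by
        ext y
        change ev (Y + Z) y = ev Y y + ev Z y
        simp only [ev, ContMDiffSection.coe_add, Pi.add_apply, map_add, mul_add]
      map_smul' := fun f Y => by
        ext y
        change ev (f • Y) y = f y * ev Y y
        simp only [ev, Sec.smul_apply, map_smul, smul_eq_mul]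
        ring }
  have hα : ev X x = 0 := congrArg (fun f : Fun E M => f x) (h α)
  simpa [ev, e.coe_linearMapAt_of_mem (R := ℝ) hx] using hα

end PqN

/-! ### Assembly of the structure. -/

theorem mainTheorem4
    {E : Type*} [NormedAddCommGroup E] [NormedSpace ℝ E] [FiniteDimensional ℝ E]
    {M : Type*} [TopologicalSpace M] [T2Space M] [SigmaCompactSpace M]
    [ChartedSpace E M] [IsManifold 𝓘(ℝ, E) ((⊤ : ℕ∞) : WithTop ℕ∞) M]
    {F : Type*} [NormedAddCommGroup F] [NormedSpace ℝ F] [FiniteDimensional ℝ F]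
    {A : M → Type*} [TopologicalSpace (Bundle.TotalSpace F A)] [∀ x, TopologicalSpace (A x)]
    [FiberBundle F A] [∀ x, AddCommGroup (A x)] [∀ x, Module ℝ (A x)] [VectorBundle ℝ F A]
    [ContMDiffVectorBundle ((⊤ : ℕ∞) : WithTop ℕ∞) F A 𝓘(ℝ, E)]
    (𝒜 : PqN.LieAlgebroid E F A)
    (π : PqN.Bivector (PqN.Fun E M) (PqN.Sec E F A)) (hπ : 𝒜.toSkew.IsPoisson π)
    (ω : PqN.KForm (PqN.Fun E M) (PqN.Sec E F A) 2) :
    𝒜.toSkew.IsPoissonQuasiNijenhuisWithBackground π (π.endo ω)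
      (𝒜.toSkew.d₂ (π.twistedForm ω)) (-𝒜.toSkew.d₂ ω) := by
  have closed := 𝒜.toSkew.d₃_d₂ 𝒜.jacobi 𝒜.anchor_bracket
  refine ⟨fun α => ?_, closed _, fun W X Y Z => ?_, hπ, hπ.concomitant_endo ω,
    hπ.torsion_endo PqN.Sec.eq_zero_of_forall_dual ω, fun W X Y Z => ?_⟩
  · rw [π.dual_comp_endo, π.endo_apply]
  · rw [PqN.SkewAlgebroid.d₃_neg, closed, neg_zero]
  -- The primitive ω(N·,N·) gives d(i_N ψ) = -d𝓗; the four terms of i_N(dψ) vanish because ψ is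
  -- closed.
  · have h := closed (π.twistedForm₂ ω) W X Y Z
    rw [← hπ.insertForm_add_cyclicForm ω, PqN.SkewAlgebroid.d₃_add] at h
    rw [PqN.SkewAlgebroid.deform_d₃, closed, closed, closed, closed]
    linear_combination -h
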